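/- For a finite set $X$ let $M_X$ be the algebra of complex $X\times X$ matrices with matrix units $\epsilon_{xx'}$; for finite $X,Y$ write $XY=X\times Y$. **Stochastic operator matrices.** Let $H$ be a complex Hilbert space. A stochastic operator matrix over $(X,A)$ acting on $H$ is a positive block operator matrix $E=(E_{xx',aa'})\in M_{XA}\otimes\mathcal B(H)$ with ${\rm Tr}_A(E)=I_X\otimes I_H$, i.e. $\sum_{a}E_{xx',aa}=\delta_{xx'}I_H$. A strongly stochastic operator matrix over $(X,Y,A,B)$ acting on $H$ is a stochastic operator matrix $P=(P_{xx',yy'}^{aa',bb'})$ over $(XY,AB)$ such that, $L_\sigma$ denoting the slice map of a state $\sigma$, for all pure states $\sigma_X,\sigma_X'$ of $M_X$ and $\sigma_Y,\sigma_Y'$ of $M_Y$ the matrices ${\rm Tr}_B(L_{\sigma_Y}(P))={\rm Tr}_B(L_{\sigma_Y'}(P))$ and ${\rm Tr}_A(L_{\sigma_X}(P))={\rm Tr}_A(L_{\sigma_X'}(P))$ are equal as indicated and are stochastic over $(X,A)$ and over $(Y,B)$, respectively. **The algebra $\mathcal C_{X,A}$.** Let $\mathcal V_{X,A}$ be the universal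 ternary ring of operators generated by the entries $v_{a,x}$ ($a\in A$, $x\in X$) of a block operator isometry $V=(v_{a,x})$, and let $\mathcal C_{X,A}$ be its right C*-algebra, the closed span of $\{S^*T: S,T\in\mathcal V_{X,A}\}$. It is unital for $X\neq\emptyset$; put $e_{xx',aa'}=v_{a,x}^*v_{a',x'}$. **The algebra $\mathcal C_{XY,AB}$.** Let $\mathcal C_{XY,AB}$ be the universal unital C*-algebra generated by the entries of a positive matrix $\big(p_{xx',yy'}^{aa',bb'}\big)$ ($x,x'\in X$, $y,y'\in Y$, $a,a'\in A$, $b,b'\in B$; rows are indexed by $(x,y,a,b)$ and columns by $(x',y',a',b')$) subject to the relations $$\sum_{a}p_{xx,yy'}^{aa,bb'}=\sum_{a}p_{x'x',yy'}^{aa,bb'},\qquad \sum_{a}p_{xx',yy'}^{aa,bb'}=0\ (x\ne x'),$$ $$\sum_{b}p_{xx',yy}^{aa',bb}=\sum_{b}p_{xx',y'y'}^{aa',bb},\qquad \sum_{b}p_{xx',yy'}^{aa',bb}=0\ (y\ne y'),$$ $$\sum_{a,b}p_{xx',yy'}^{aa,bb}=\delta_{xx'}\delta_{yy'}1 .$$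 **Theorem.** Let $X_1,X_2,A_1,A_2$ be finite sets with $X_1,X_2\neq\emptyset$, let $H,K$ be Hilbert spaces, and let $\pi:\mathcal C_{X_1,A_1}\to\mathcal B(H)$ and $\rho:\mathcal C_{X_2A_1,X_1A_2}\to\mathcal B(K)$ be non-zero $*$-representations ($*$-homomorphisms, not necessarily unital). Put $E=(\pi(e_{x_1x_1',a_1a_1'}))$, $P=\big(\rho(p_{x_2x_2',a_1a_1'}^{x_1x_1',a_2a_2'})\big)$ and $F=L_{J_{X_1}\otimes J_{A_1}}(E\otimes P)$, where $J_Z=\sum_{z,z'}\epsilon_{zz'}\otimes\epsilon_{zz'}$; that is, $$F_{x_2x_2',a_2a_2'}=\sum_{x_1,x_1'\in X_1}\ \sum_{a_1,a_1'\in A_1}\pi(e_{x_1x_1',a_1a_1'})\otimes\rho\big(p_{x_2x_2',a_1a_1'}^{x_1x_1',a_2a_2'}\big)\in\mathcal B(H\otimes K).$$ Then: 1. If $\pi$ is unital, $E$ is a stochastic operator matrix over $(X_1,A_1)$. 2. If $\rho$ is unital, $P$ is a strongly stochastic operator matrix over $(X_2,A_1,X_1,A_2)$. 3. If $\pi$ and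 $\rho$ are unital, $F$ is a stochastic operator matrix over $(X_2,A_2)$. 4. There is a non-zero $*$-representation $\tilde\pi:\mathcal C_{X_2,A_2}\to\mathcal B(H\otimes K)$ with $\tilde\pi(e_{x_2x_2',a_2a_2'})=F_{x_2x_2',a_2a_2'}$ for all $x_2,x_2'\in X_2$, $a_2,a_2'\in A_2$, and $\tilde\pi(1)=\pi(1)\otimes\rho(1)$; in particular $\tilde\pi$ is unital if $\pi$ and $\rho$ are. -/

import Mathlib

open scoped ENNReal TensorProduct InnerProductSpace ComplexOrder

universe u v w v' w'

/-! ### Products of algebras of bounded operators -/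

section Products

variable {I : Type v} (H : I → Type u) [∀ i, NormedAddCommGroup (H i)]
  [∀ i, InnerProductSpace ℂ (H i)] [∀ i, CompleteSpace (H i)] [∀ i, Nontrivial (H i)]

/-- The `ℓ^∞`-direct product of the algebras `B(H i)` (bounded families, supremum norm, pointwise
operations), where all the Hilbert spaces `H i` are nonzero. -/
abbrev OpProd : Type (max u v) := lp (fun i => H i →L[ℂ] H i) ∞

noncomputable instance OpProd.instCStarAlgebra : CStarAlgebra (OpProd H) where
  toNormedRing := lp.inftyNormedRing
  toStarRing := lp.inftyStarRing
  toCompleteSpace := inferInstance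
  toCStarRing := lp.inftyCStarRing
  toNormedAlgebra := lp.inftyNormedAlgebra
  toStarModule := inferInstance

end Products

/-! ### Operator matrices -/

section OperatorMatrices

variable {X : Type v} {A : Type w} {Y : Type v'} {B : Type w'}
variable {H : Type u} [NormedAddCommGroup H] [InnerProductSpace ℂ H]

/-- Positivity of a block operator matrix `E = (E i j)`, as an operator on the direct sum of
copies of `H`: `⟨E ξ, ξ⟩ ≥ 0` for all `ξ = (ξ i)`. -/
def IsPositiveOpMatrix {ι : Type v} [Fintype ι] (E : Matrix ι ι (H →L[ℂ] H)) : Prop :=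
  ∀ ξ : ι → H, 0 ≤ ∑ i, ∑ j, ⟪ξ i, E i j (ξ j)⟫_ℂ

/-- The partial trace `Tr_A : M_{XA} ⊗ B(H) → M_X ⊗ B(H)`. -/
def opPartialTrace [Fintype A] (E : Matrix (X × A) (X × A) (H →L[ℂ] H)) :
    Matrix X X (H →L[ℂ] H) :=
  Matrix.of fun x x' => ∑ a, E (x, a) (x', a)

/-- Stochastic operator matrices over `(X, A)` acting on `H`; the entry `E_{x,x',a,a'}` is
`E (x, a) (x', a')`. -/
def IsStochasticOpMatrix [Fintype X] [Fintype A] [DecidableEq X]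
    (E : Matrix (X × A) (X × A) (H →L[ℂ] H)) : Prop :=
  IsPositiveOpMatrix E ∧ opPartialTrace E = 1

/-- Pure states of `M_X`, as density matrices: the rank one projections `ξ ξ^*`, `‖ξ‖ = 1`. -/
def IsPureStateMatrix [Fintype X] (σ : Matrix X X ℂ) : Prop :=
  ∃ ξ : EuclideanSpace ℂ X, ‖ξ‖ = 1 ∧ σ = Matrix.of fun x x' => ξ x * star (ξ x')

/-- `Tr_B (L_{σ_Y} P)`, for `P ∈ M_{XYAB} ⊗ B(H)` and `σ ∈ M_Y`; here `L_{σ_Y}` is the slice map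
`ε_{y y'} ↦ Tr (ε_{y y'} σ) = σ y' y` on the tensor factor `M_Y`. -/
noncomputable def traceSliceRight [Fintype Y] [Fintype B] (σ : Matrix Y Y ℂ)
    (P : Matrix ((X × Y) × (A × B)) ((X × Y) × (A × B)) (H →L[ℂ] H)) :
    Matrix (X × A) (X × A) (H →L[ℂ] H) :=
  Matrix.of fun s t => ∑ b, ∑ y, ∑ y',
    σ y' y • P ((s.1, y), (s.2, b)) ((t.1, y'), (t.2, b))

/-- `Tr_A (L_{σ_X} P)`, for `P ∈ M_{XYAB} ⊗ B(H)` and `σ ∈ M_X`. -/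
noncomputable def traceSliceLeft [Fintype X] [Fintype A] (σ : Matrix X X ℂ)
    (P : Matrix ((X × Y) × (A × B)) ((X × Y) × (A × B)) (H →L[ℂ] H)) :
    Matrix (Y × B) (Y × B) (H →L[ℂ] H) :=
  Matrix.of fun s t => ∑ a, ∑ x, ∑ x',
    σ x' x • P ((x, s.1), (a, s.2)) ((x', t.1), (a, t.2))

/-- Strongly stochastic operator matrices over `(X, Y, A, B)` acting on `H`; the entry
`P_{xx',yy'}^{aa',bb'}` is `P ((x, y), (a, b)) ((x', y'), (a', b'))`. -/
structure IsStronglyStochasticOpMatrix [Fintype X] [Fintype Y] [Fintype A] [Fintype B]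
    [DecidableEq X] [DecidableEq Y]
    (P : Matrix ((X × Y) × (A × B)) ((X × Y) × (A × B)) (H →L[ℂ] H)) : Prop where
  stochastic : IsStochasticOpMatrix P
  right_stochastic : ∀ σ : Matrix Y Y ℂ, IsPureStateMatrix σ →
    IsStochasticOpMatrix (traceSliceRight σ P)
  right_eq : ∀ σ σ' : Matrix Y Y ℂ, IsPureStateMatrix σ → IsPureStateMatrix σ' →
    traceSliceRight σ P = traceSliceRight σ' P
  left_stochastic : ∀ σ : Matrix X X ℂ, IsPureStateMatrix σ →
    IsStochasticOpMatrix (traceSliceLeft σ P)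
  left_eq : ∀ σ σ' : Matrix X X ℂ, IsPureStateMatrix σ → IsPureStateMatrix σ' →
    traceSliceLeft σ P = traceSliceLeft σ' P

/-- The entries of a positive operator matrix whose diagonal entries are dominated by the identity
are contractions. -/
theorem IsPositiveOpMatrix.norm_entry_le {ι : Type v} [Fintype ι] [DecidableEq ι]
    {E : Matrix ι ι (H →L[ℂ] H)} (hE : IsPositiveOpMatrix E)
    (hd : ∀ i (ξ : H), (⟪ξ, E i i ξ⟫_ℂ).re ≤ ‖ξ‖ ^ 2) (i j : ι) : ‖E i j‖ ≤ 1 := by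
  have key : ∀ a b : H,
      0 ≤ ⟪a, E i i a⟫_ℂ + ⟪a, E i j b⟫_ℂ + (⟪b, E j i a⟫_ℂ + ⟪b, E j j b⟫_ℂ) := by
    intro a b
    have hQ := hE (Pi.single i a + Pi.single j b)
    have h1 : ∀ (c d : H) (k l : ι),
        ∑ m, ∑ n, ⟪(Pi.single k c : ι → H) m, E m n ((Pi.single l d : ι → H) n)⟫_ℂ
          = ⟪c, E k l d⟫_ℂ := by
      intro c d k l
      rw [Finset.sum_eq_single k]
      · rw [Finset.sum_eq_single l]
        · simp
        · intro n _ hn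
          simp [Pi.single_eq_of_ne hn]
        · simp
      · intro m _ hm
        simp [Pi.single_eq_of_ne hm]
      · simp
    have h2 : ∑ m, ∑ n, ⟪(Pi.single i a + Pi.single j b : ι → H) m,
        E m n ((Pi.single i a + Pi.single j b : ι → H) n)⟫_ℂ
          = ⟪a, E i i a⟫_ℂ + ⟪a, E i j b⟫_ℂ + (⟪b, E j i a⟫_ℂ + ⟪b, E j j b⟫_ℂ) := by
      simp only [Pi.add_apply, map_add, inner_add_left, inner_add_right,
        Finset.sum_add_distrib, h1]
      ring
    rwa [h2] at hQ
  refine ContinuousLinearMap.opNorm_le_bound _ zero_le_one fun b => ?_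
  set c := E i j b with hc
  have him : ∀ a : H, (⟪a, c⟫_ℂ).im + (⟪b, E j i a⟫_ℂ).im = 0 := by
    intro a
    have h1 := (Complex.le_def.1 (key a b)).2
    have h2 := (Complex.le_def.1 (key a 0)).2
    have h3 := (Complex.le_def.1 (key 0 b)).2
    simp only [map_zero, inner_zero_left, inner_zero_right, add_zero, zero_add,
      Complex.add_im, Complex.zero_im] at h1 h2 h3
    linarith
  have hre : (⟪b, E j i (-c)⟫_ℂ).re = (⟪-c, c⟫_ℂ).re := by
    have h := him (Complex.I • (-c))
    simp only [map_smul, inner_smul_left, inner_smul_right, Complex.conj_I, Complex.mul_im,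
      Complex.neg_re, Complex.neg_im, Complex.I_re, Complex.I_im] at h
    linarith
  have hk := (Complex.le_def.1 (key (-c) b)).1
  have hcc : (⟪-c, c⟫_ℂ).re = -‖c‖ ^ 2 := by
    rw [inner_neg_left, Complex.neg_re]
    congr 1
    exact inner_self_eq_norm_sq (𝕜 := ℂ) c
  have hd1 := hd i (-c)
  have hd2 := hd j b
  rw [norm_neg] at hd1
  simp only [Complex.add_re, Complex.zero_re] at hk
  rw [hre, ← hc, hcc] at hk
  rw [one_mul]
  exact (sq_le_sq₀ (norm_nonneg _) (norm_nonneg _)).1 (by linarith)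

end OperatorMatrices

/-! ### The Hilbert space tensor product -/

section HilbertTensor

variable (H : Type u) [NormedAddCommGroup H] [InnerProductSpace ℂ H]
variable (K : Type v) [NormedAddCommGroup K] [InnerProductSpace ℂ K]

/-- The Hilbert space tensor product `H ⊗ K`: the completion of the algebraic one. -/
def HilbertTensor : Type (max u v) := UniformSpace.Completion (H ⊗[ℂ] K)

noncomputable instance HilbertTensor.instNormedAddCommGroup :
    NormedAddCommGroup (HilbertTensor H K) :=
  inferInstanceAs (NormedAddCommGroup (UniformSpace.Completion (H ⊗[ℂ] K)))

noncomputable instance HilbertTensor.instInnerProductSpace :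
    InnerProductSpace ℂ (HilbertTensor H K) :=
  inferInstanceAs (InnerProductSpace ℂ (UniformSpace.Completion (H ⊗[ℂ] K)))

instance HilbertTensor.instCompleteSpace : CompleteSpace (HilbertTensor H K) :=
  inferInstanceAs (CompleteSpace (UniformSpace.Completion (H ⊗[ℂ] K)))

variable {H K}

/-- The elementary tensors `ξ ⊗ η ∈ H ⊗ K`. -/
noncomputable def HilbertTensor.tmul (ξ : H) (η : K) : HilbertTensor H K :=
  ((ξ ⊗ₜ[ℂ] η : H ⊗[ℂ] K) : UniformSpace.Completion (H ⊗[ℂ] K))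

/-- The tensor product `S ⊗ T ∈ B(H ⊗ K)` of bounded operators. -/
noncomputable def opTensor (S : H →L[ℂ] H) (T : K →L[ℂ] K) :
    HilbertTensor H K →L[ℂ] HilbertTensor H K where
  toFun := (TensorProduct.mapL S T).completion
  map_add' := (TensorProduct.mapL S T).completion.map_add
  map_smul' := (TensorProduct.mapL S T).completion.map_smul
  cont := (TensorProduct.mapL S T).completion.continuous

theorem HilbertTensor.inner_tmul (ξ ξ' : H) (η η' : K) :
    ⟪HilbertTensor.tmul ξ η, HilbertTensor.tmul ξ' η'⟫_ℂ = ⟪ξ, ξ'⟫_ℂ * ⟪η, η'⟫_ℂ :=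
  (UniformSpace.Completion.inner_coe (𝕜 := ℂ) (ξ ⊗ₜ[ℂ] η) (ξ' ⊗ₜ[ℂ] η')).trans
    (TensorProduct.inner_tmul ..)

theorem opTensor_tmul (S : H →L[ℂ] H) (T : K →L[ℂ] K) (ξ : H) (η : K) :
    opTensor S T (HilbertTensor.tmul ξ η) = HilbertTensor.tmul (S ξ) (T η) :=
  UniformSpace.Completion.map_coe (TensorProduct.mapL S T).uniformContinuous (ξ ⊗ₜ[ℂ] η)

/-- `L_{J_{X₁} ⊗ J_{A₁}} (E ⊗ P)`: the slice of `E ⊗ P` along the (unnormalised) maximally entangled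
functionals `ε_{x x'} ⊗ ε_{z z'} ↦ δ_{x z} δ_{x' z'}` on the two copies of `M_{X₁}` and on the two
copies of `M_{A₁}`; an element of `M_{X₂ A₂} ⊗ B(H ⊗ K)`. -/
noncomputable def sliceJ {X₁ : Type*} {A₁ : Type*} {X₂ : Type*} {A₂ : Type*}
    [Fintype X₁] [Fintype A₁]
    (E : Matrix (X₁ × A₁) (X₁ × A₁) (H →L[ℂ] H))
    (P : Matrix ((X₂ × A₁) × (X₁ × A₂)) ((X₂ × A₁) × (X₁ × A₂)) (K →L[ℂ] K)) :
    Matrix (X₂ × A₂) (X₂ × A₂) (HilbertTensor H K →L[ℂ] HilbertTensor H K) :=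
  Matrix.of fun s t => ∑ x, ∑ x', ∑ a, ∑ a',
    opTensor (E (x, a) (x', a')) (P ((s.1, a), (x, s.2)) ((t.1, a'), (x', t.2)))

end HilbertTensor

/-! ### The C*-algebra `C_{X,A}` -/

/-- A block operator isometry `V = (V_{a,x}) : H^X → K^A`, with `H ≠ 0`. -/
structure BlockIsometry (X : Type v) (A : Type w) [Fintype A] [DecidableEq X] where
  H : Type u
  K : Type u
  [normH : NormedAddCommGroup H]
  [innerH : InnerProductSpace ℂ H]
  [completeH : CompleteSpace H]
  [nontrivialH : Nontrivial H]
  [normK : NormedAddCommGroup K]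
  [innerK : InnerProductSpace ℂ K]
  [completeK : CompleteSpace K]
  V : A → X → H →L[ℂ] K
  isometry : ∀ x x' : X,
    ∑ a, ContinuousLinearMap.adjoint (V a x) ∘L V a x' = if x = x' then 1 else 0

attribute [instance] BlockIsometry.normH BlockIsometry.innerH BlockIsometry.completeH
  BlockIsometry.nontrivialH BlockIsometry.normK BlockIsometry.innerK BlockIsometry.completeK

section StochasticAlgebra

variable (X : Type v) (A : Type w) [Fintype A] [DecidableEq X]

/-- The `ℓ^∞`-product of the spaces `B(H, K)` over all block operator isometries. -/
noncomputable abbrev BlockIsometryProd :=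
  lp (fun i : BlockIsometry.{u, v, w} X A => i.H →L[ℂ] i.K) ∞

variable {X A}

theorem BlockIsometry.norm_le (i : BlockIsometry.{u, v, w} X A) (a : A) (x : X) :
    ‖i.V a x‖ ≤ 1 := by
  refine ContinuousLinearMap.opNorm_le_bound _ zero_le_one fun ξ => ?_
  have h : ∑ b, ‖i.V b x ξ‖ ^ 2 = ‖ξ‖ ^ 2 := by
    have h1 := congrArg (fun T : i.H →L[ℂ] i.H => (⟪ξ, T ξ⟫_ℂ).re) (i.isometry x x)
    simp only [if_true, sum_apply, ContinuousLinearMap.comp_apply, inner_sum,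
      ContinuousLinearMap.adjoint_inner_right, one_apply_eq_self, Complex.re_sum] at h1
    calc ∑ b, ‖i.V b x ξ‖ ^ 2 = ∑ b, (⟪i.V b x ξ, i.V b x ξ⟫_ℂ).re :=
          Finset.sum_congr rfl fun b _ => (inner_self_eq_norm_sq (𝕜 := ℂ) _).symm
      _ = (⟪ξ, ξ⟫_ℂ).re := h1
      _ = ‖ξ‖ ^ 2 := inner_self_eq_norm_sq (𝕜 := ℂ) _
  have h2 : ‖i.V a x ξ‖ ^ 2 ≤ ∑ b, ‖i.V b x ξ‖ ^ 2 :=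
    Finset.single_le_sum (f := fun b => ‖i.V b x ξ‖ ^ 2) (fun b _ => sq_nonneg _)
      (Finset.mem_univ a)
  rw [one_mul]
  exact (sq_le_sq₀ (norm_nonneg _) (norm_nonneg _)).1 (h2.trans h.le)

/-- The generators `v_{a,x}` of the universal TRO. -/
noncomputable def troGen (a : A) (x : X) : BlockIsometryProd.{u, v, w} X A :=
  ⟨fun i => i.V a x, memℓp_infty ⟨1, by rintro _ ⟨i, rfl⟩; exact i.norm_le a x⟩⟩

/-- The ternary product `[S, T, R] = S T^* R`. -/
noncomputable def troTriple (S T R : BlockIsometryProd.{u, v, w} X A) :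
    BlockIsometryProd.{u, v, w} X A :=
  ⟨fun i => S i ∘L ContinuousLinearMap.adjoint (T i) ∘L R i, by
    refine memℓp_infty ⟨‖S‖ * (‖T‖ * ‖R‖), ?_⟩
    rintro _ ⟨i, rfl⟩
    have hS := lp.norm_apply_le_norm ENNReal.top_ne_zero S i
    have hT := lp.norm_apply_le_norm ENNReal.top_ne_zero T i
    have hR := lp.norm_apply_le_norm ENNReal.top_ne_zero R i
    have hT' : ‖ContinuousLinearMap.adjoint (T i)‖ ≤ ‖T‖ := by
      rwa [LinearIsometryEquiv.norm_map]
    exact (ContinuousLinearMap.opNorm_comp_le _ _).trans (mul_le_mul hS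
      ((ContinuousLinearMap.opNorm_comp_le _ _).trans
        (mul_le_mul hT' hR (norm_nonneg _) (norm_nonneg _))) (norm_nonneg _) (norm_nonneg _))⟩

/-- The product `S^* T`. -/
noncomputable def troInner (S T : BlockIsometryProd.{u, v, w} X A) :
    OpProd (fun i : BlockIsometry.{u, v, w} X A => i.H) :=
  ⟨fun i => ContinuousLinearMap.adjoint (S i) ∘L T i, by
    refine memℓp_infty ⟨‖S‖ * ‖T‖, ?_⟩
    rintro _ ⟨i, rfl⟩
    have hS := lp.norm_apply_le_norm ENNReal.top_ne_zero S i
    have hT := lp.norm_apply_le_norm ENNReal.top_ne_zero T i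
    have hS' : ‖ContinuousLinearMap.adjoint (S i)‖ ≤ ‖S‖ := by
      rwa [LinearIsometryEquiv.norm_map]
    exact (ContinuousLinearMap.opNorm_comp_le _ _).trans
      (mul_le_mul hS' hT (norm_nonneg _) (norm_nonneg _))⟩

variable (X A)

/-- The universal TRO `V_{X,A}` generated by the entries of a block operator isometry: the smallest
closed subspace which contains the `v_{a,x}` and is closed under the ternary product. -/
noncomputable def universalTRO : Submodule ℂ (BlockIsometryProd.{u, v, w} X A) :=
  sInf {W | IsClosed (W : Set (BlockIsometryProd.{u, v, w} X A)) ∧ (∀ a x, troGen a x ∈ W) ∧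
    ∀ S ∈ W, ∀ T ∈ W, ∀ R ∈ W, troTriple S T R ∈ W}

/-- The C*-algebra `C_{X,A}`: the (unital) C*-algebra generated by the products `S^* T`,
`S, T ∈ V_{X,A}`. (For nonempty `X`, the closed span of these products is already a C*-algebra and
contains the unit `∑ a, v_{a,x}^* v_{a,x}`, so that this is the right C*-algebra of `V_{X,A}`.) -/
noncomputable def stochasticSubalgebra :
    StarSubalgebra ℂ (OpProd (fun i : BlockIsometry.{u, v, w} X A => i.H)) :=
  (StarAlgebra.adjoin ℂ
    {z | ∃ S ∈ universalTRO.{u, v, w} X A, ∃ T ∈ universalTRO.{u, v, w} X A,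
      z = troInner S T}).topologicalClosure

instance stochasticSubalgebra.instIsClosed :
    IsClosed (stochasticSubalgebra.{u, v, w} X A :
      Set (OpProd (fun i : BlockIsometry.{u, v, w} X A => i.H))) :=
  StarSubalgebra.isClosed_topologicalClosure _

/-- The C*-algebra `C_{X,A}` as a type. -/
def StochasticCStar : Type (max (u + 1) v w) := ↥(stochasticSubalgebra.{u, v, w} X A)

noncomputable instance StochasticCStar.instCStarAlgebra :
    CStarAlgebra (StochasticCStar.{u, v, w} X A) :=
  inferInstanceAs (CStarAlgebra ↥(stochasticSubalgebra.{u, v, w} X A))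

variable {X A}

theorem troGen_mem (a : A) (x : X) : troGen a x ∈ universalTRO.{u, v, w} X A := by
  rw [universalTRO, Submodule.mem_sInf]
  exact fun W hW => hW.2.1 a x

/-- The canonical generators `e_{x,x',a,a'} = v_{a,x}^* v_{a',x'}` of `C_{X,A}`. -/
noncomputable def stochasticGen (x x' : X) (a a' : A) : StochasticCStar.{u, v, w} X A :=
  ⟨troInner (troGen a x) (troGen a' x'), StarSubalgebra.le_topologicalClosure _
    (StarAlgebra.subset_adjoin ℂ _ ⟨_, troGen_mem a x, _, troGen_mem a' x', rfl⟩)⟩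

end StochasticAlgebra

/-! ### The universal C*-algebra `C_{XY,AB}` -/

/-- A representation, on a nonzero Hilbert space, of the defining relations of `C_{XY,AB}`: a
positive operator matrix `P = (P_{xx',yy'}^{aa',bb'})` satisfying the five families of linear
relations. -/
structure StrongRelationsRep (X : Type v) (Y : Type v') (A : Type w) (B : Type w')
    [Fintype X] [Fintype Y] [Fintype A] [Fintype B] [DecidableEq X] [DecidableEq Y] where
  H : Type u
  [normH : NormedAddCommGroup H]
  [innerH : InnerProductSpace ℂ H]
  [completeH : CompleteSpace H]
  [nontrivialH : Nontrivial H]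
  P : X → X → Y → Y → A → A → B → B → H →L[ℂ] H
  positive : IsPositiveOpMatrix
    (Matrix.of fun s t : (X × Y) × (A × B) =>
      P s.1.1 t.1.1 s.1.2 t.1.2 s.2.1 t.2.1 s.2.2 t.2.2)
  rel_one : ∀ (x x' : X) (y y' : Y) (b b' : B),
    ∑ a, P x x y y' a a b b' = ∑ a, P x' x' y y' a a b b'
  rel_two : ∀ (x x' : X) (y y' : Y) (b b' : B), x ≠ x' → ∑ a, P x x' y y' a a b b' = 0
  rel_three : ∀ (x x' : X) (y y' : Y) (a a' : A),
    ∑ b, P x x' y y a a' b b = ∑ b, P x x' y' y' a a' b b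
  rel_four : ∀ (x x' : X) (y y' : Y) (a a' : A), y ≠ y' → ∑ b, P x x' y y' a a' b b = 0
  rel_five : ∀ (x x' : X) (y y' : Y),
    ∑ a, ∑ b, P x x' y y' a a b b = if x = x' ∧ y = y' then 1 else 0

attribute [instance] StrongRelationsRep.normH StrongRelationsRep.innerH
  StrongRelationsRep.completeH StrongRelationsRep.nontrivialH

section StrongAlgebra

variable {X : Type v} {Y : Type v'} {A : Type w} {B : Type w'}
  [Fintype X] [Fintype Y] [Fintype A] [Fintype B] [DecidableEq X] [DecidableEq Y]

theorem StrongRelationsRep.norm_le (i : StrongRelationsRep.{u, v, w, v', w'} X Y A B)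
    (x x' : X) (y y' : Y) (a a' : A) (b b' : B) : ‖i.P x x' y y' a a' b b'‖ ≤ 1 := by
  classical
  refine i.positive.norm_entry_le (fun s ξ => ?_) ((x, y), (a, b)) ((x', y'), (a', b'))
  obtain ⟨⟨z, t⟩, c, d⟩ := s
  have hnn : ∀ (a : A) (b : B), 0 ≤ (⟪ξ, i.P z z t t a a b b ξ⟫_ℂ).re := by
    intro a b
    have h := i.positive (Pi.single ((z, t), (a, b)) ξ)
    rw [Finset.sum_eq_single ((z, t), (a, b)), Finset.sum_eq_single ((z, t), (a, b))] at h
    · simpa using (Complex.le_def.1 h).1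
    · intro n _ hn
      simp [Pi.single_eq_of_ne hn]
    · simp
    · intro n _ hn
      simp [Pi.single_eq_of_ne hn]
    · simp
  have h1 := congrArg (fun T : i.H →L[ℂ] i.H => (⟪ξ, T ξ⟫_ℂ).re) (i.rel_five z z t t)
  simp only [and_self, if_true, sum_apply, inner_sum,
    one_apply_eq_self, Complex.re_sum] at h1
  have h2 : (⟪ξ, ξ⟫_ℂ).re = ‖ξ‖ ^ 2 := inner_self_eq_norm_sq (𝕜 := ℂ) ξ
  have h3 : (⟪ξ, i.P z z t t c c d d ξ⟫_ℂ).re ≤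
      ∑ b, (⟪ξ, i.P z z t t c c b b ξ⟫_ℂ).re :=
    Finset.single_le_sum (f := fun b => (⟪ξ, i.P z z t t c c b b ξ⟫_ℂ).re)
      (fun b _ => hnn c b) (Finset.mem_univ d)
  have h4 : ∑ b, (⟪ξ, i.P z z t t c c b b ξ⟫_ℂ).re ≤
      ∑ a, ∑ b, (⟪ξ, i.P z z t t a a b b ξ⟫_ℂ).re :=
    Finset.single_le_sum (f := fun a => ∑ b, (⟪ξ, i.P z z t t a a b b ξ⟫_ℂ).re)
      (fun a _ => Finset.sum_nonneg fun b _ => hnn a b) (Finset.mem_univ c)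
  exact h3.trans (h4.trans (h1.trans h2).le)

/-- The family of all representing operators for the generator `p_{xx',yy'}^{aa',bb'}`. -/
noncomputable def strongFamily (x x' : X) (y y' : Y) (a a' : A) (b b' : B) :
    OpProd (fun i : StrongRelationsRep.{u, v, w, v', w'} X Y A B => i.H) :=
  ⟨fun i => i.P x x' y y' a a' b b',
    memℓp_infty ⟨1, by rintro _ ⟨i, rfl⟩; exact i.norm_le x x' y y' a a' b b'⟩⟩

variable (X Y A B)

/-- The universal C*-algebra `C_{XY,AB}`: the C*-algebra generated by the generators in the direct
product of all the representations of the relations. -/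
noncomputable def strongSubalgebra :
    StarSubalgebra ℂ (OpProd (fun i : StrongRelationsRep.{u, v, w, v', w'} X Y A B => i.H)) :=
  (StarAlgebra.adjoin ℂ
    {z | ∃ (x x' : X) (y y' : Y) (a a' : A) (b b' : B),
      z = strongFamily x x' y y' a a' b b'}).topologicalClosure

instance strongSubalgebra.instIsClosed :
    IsClosed (strongSubalgebra.{u, v, w, v', w'} X Y A B :
      Set (OpProd (fun i : StrongRelationsRep.{u, v, w, v', w'} X Y A B => i.H))) :=
  StarSubalgebra.isClosed_topologicalClosure _

/-- The universal C*-algebra `C_{XY,AB}` as a type. -/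
def StrongCStar : Type (max (u + 1) v w v' w') :=
  ↥(strongSubalgebra.{u, v, w, v', w'} X Y A B)

noncomputable instance StrongCStar.instCStarAlgebra :
    CStarAlgebra (StrongCStar.{u, v, w, v', w'} X Y A B) :=
  inferInstanceAs (CStarAlgebra ↥(strongSubalgebra.{u, v, w, v', w'} X Y A B))

variable {X Y A B}

/-- The canonical generators `p_{xx',yy'}^{aa',bb'}` of `C_{XY,AB}`. -/
noncomputable def strongGen (x x' : X) (y y' : Y) (a a' : A) (b b' : B) :
    StrongCStar.{u, v, w, v', w'} X Y A B :=
  ⟨strongFamily x x' y y' a a' b b', StarSubalgebra.le_topologicalClosure _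
    (StarAlgebra.subset_adjoin ℂ _ ⟨x, x', y, y', a, a', b, b', rfl⟩)⟩

end StrongAlgebra

/-! ### Positive matrices over a C*-algebra, tested in a separating family of representations -/

section Positivity

/-! The proof rests on Gram factorisations inside the algebras. The generator matrix of each of
`C_{X,A}` and `C_{XY,AB}` is positive in every coordinate representation, and these separate points.
Positivity therefore holds over the algebra itself: `e = c^* c` and `p = d^* d` with entries of `c`,
`d` in the algebra (`exists_eq_sum_star_mul`). An arbitrary `*`-homomorphism, which need not be a
coordinate representation, preserves such identities, so `E` and `P` are positive.

Slicing along `J ⊗ J` contracts with an unnormalised maximally entangled vector, so the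
factorisations of `E` and `P` combine to `F = G^* G`, where the entries of `G` are sums of `π(c) ⊗
ρ(d)` (`sliceJ_eq_sum_star_mul`). The relations for `p` and `e` collapse the partial trace of `F` to
`δ_{x x'} π(1) ⊗ ρ(1)` (`sum_sliceJ`). Hence `G` is a block isometry on the range of the projection
`π(1) ⊗ ρ(1)`. The universal property of `C_{X₂,A₂}` gives a unital representation on that range,
which is extended by zero (`StochasticCStar.exists_rep`).

Strong stochasticity of `P` is linear apart from positivity: the relations make both marginals
independent of the state being sliced (`IsStronglyStochasticOpMatrix.of_relations`). -/

theorem IsPositiveOpMatrix.of_eq_sum_star_mul {H : Type*} [NormedAddCommGroup H]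
    [InnerProductSpace ℂ H] [CompleteSpace H] {ι κ : Type*} [Fintype ι] [Fintype κ]
    {E : Matrix ι ι (H →L[ℂ] H)} (c : κ → ι → H →L[ℂ] H)
    (h : ∀ i j, E i j = ∑ k, star (c k i) * c k j) : IsPositiveOpMatrix E := by
  intro ξ
  have key : ∑ i, ∑ j, ⟪ξ i, E i j (ξ j)⟫_ℂ
      = ∑ k, ⟪∑ i, c k i (ξ i), ∑ j, c k j (ξ j)⟫_ℂ := by
    simp only [h, sum_apply, mul_apply_eq_comp,
      ContinuousLinearMap.star_eq_adjoint, inner_sum, sum_inner,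
      ContinuousLinearMap.adjoint_inner_right]
    calc _ = ∑ i, ∑ k, ∑ j, ⟪c k i (ξ i), c k j (ξ j)⟫_ℂ :=
          Finset.sum_congr rfl fun i _ => Finset.sum_comm
      _ = ∑ k, ∑ i, ∑ j, ⟪c k i (ξ i), c k j (ξ j)⟫_ℂ := Finset.sum_comm
      _ = _ := Finset.sum_congr rfl fun k _ => Finset.sum_comm
  rw [key]
  refine Finset.sum_nonneg fun k _ => ?_
  rw [inner_self_eq_norm_sq_to_K]
  simp

/-- A vector supported in coordinate `i` gives `-∑ l, ‖c l i ξ‖ ^ 2 ≥ 0`, so every term vanishes. -/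
theorem eq_zero_of_sum_star_mul_neg {H : Type*} [NormedAddCommGroup H]
    [InnerProductSpace ℂ H] [CompleteSpace H] {ι κ : Type*} [Fintype ι] [DecidableEq ι] [Fintype κ]
    (c : κ → ι → H →L[ℂ] H)
    (h : IsPositiveOpMatrix (Matrix.of fun i j => -∑ k, star (c k i) * c k j)) (k : κ) (i : ι) :
    c k i = 0 := by
  ext ξ
  have h1 := h (Pi.single i ξ)
  rw [Finset.sum_eq_single i, Finset.sum_eq_single i] at h1
  · simp only [Matrix.of_apply, Pi.single_eq_same, neg_apply, sum_apply,
      mul_apply_eq_comp, ContinuousLinearMap.star_eq_adjoint, inner_neg_right,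
      inner_sum, ContinuousLinearMap.adjoint_inner_right] at h1
    have h2 := (Complex.le_def.1 h1).1
    simp only [Complex.zero_re, Complex.neg_re, Complex.re_sum] at h2
    have h3 : ∀ l, (⟪c l i ξ, c l i ξ⟫_ℂ).re = ‖c l i ξ‖ ^ 2 :=
      fun l => inner_self_eq_norm_sq (𝕜 := ℂ) _
    simp only [h3] at h2
    have h4 : ‖c k i ξ‖ ^ 2 ≤ ∑ l, ‖c l i ξ‖ ^ 2 :=
      Finset.single_le_sum (f := fun l => ‖c l i ξ‖ ^ 2) (fun l _ => sq_nonneg _)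
        (Finset.mem_univ k)
    have h5 : ‖c k i ξ‖ ^ 2 = 0 := le_antisymm (by linarith) (sq_nonneg _)
    simpa using h5
  · intro n _ hn
    simp [Pi.single_eq_of_ne hn]
  · simp
  · intro n _ hn
    simp [Pi.single_eq_of_ne hn]
  · simp

theorem IsPositiveOpMatrix.conj {H : Type*} [NormedAddCommGroup H]
    [InnerProductSpace ℂ H] [CompleteSpace H] {ι κ : Type*} [Fintype ι] [Fintype κ]
    {E : Matrix ι ι (H →L[ℂ] H)} (hE : IsPositiveOpMatrix E) (b : ι → κ → H →L[ℂ] H) :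
    IsPositiveOpMatrix (Matrix.of fun k l => ∑ i, ∑ j, star (b i k) * E i j * b j l) := by
  intro ξ
  have h := hE fun i => ∑ k, b i k (ξ k)
  convert h using 1
  simp only [Matrix.of_apply, sum_apply, mul_apply_eq_comp, map_sum,
    ContinuousLinearMap.star_eq_adjoint, inner_sum, sum_inner,
    ContinuousLinearMap.adjoint_inner_right]
  calc _ = ∑ k, ∑ i, ∑ l, ∑ j, ⟪b i k (ξ k), E i j (b j l (ξ l))⟫_ℂ :=
        Finset.sum_congr rfl fun k _ => Finset.sum_comm
    _ = ∑ i, ∑ k, ∑ l, ∑ j, ⟪b i k (ξ k), E i j (b j l (ξ l))⟫_ℂ := Finset.sum_comm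
    _ = ∑ i, ∑ k, ∑ j, ∑ l, ⟪b i k (ξ k), E i j (b j l (ξ l))⟫_ℂ :=
        Finset.sum_congr rfl fun i _ => Finset.sum_congr rfl fun k _ => Finset.sum_comm
    _ = ∑ i, ∑ j, ∑ k, ∑ l, ⟪b i k (ξ k), E i j (b j l (ξ l))⟫_ℂ :=
        Finset.sum_congr rfl fun i _ => Finset.sum_comm
    _ = _ := Finset.sum_congr rfl fun i _ => Finset.sum_congr rfl fun j _ => Finset.sum_comm

/-- A positive operator matrix is hermitian. -/
theorem IsPositiveOpMatrix.star_entry {H : Type*} [NormedAddCommGroup H]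
    [InnerProductSpace ℂ H] [CompleteSpace H] {ι : Type*} [Fintype ι] [DecidableEq ι]
    {E : Matrix ι ι (H →L[ℂ] H)} (hE : IsPositiveOpMatrix E) (i j : ι) :
    star (E i j) = E j i := by
  have key : ∀ a b : H,
      0 ≤ ⟪a, E i i a⟫_ℂ + ⟪a, E i j b⟫_ℂ + (⟪b, E j i a⟫_ℂ + ⟪b, E j j b⟫_ℂ) := by
    intro a b
    have hQ := hE (Pi.single i a + Pi.single j b)
    have h1 : ∀ (c d : H) (k l : ι),
        ∑ m, ∑ n, ⟪(Pi.single k c : ι → H) m, E m n ((Pi.single l d : ι → H) n)⟫_ℂ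
          = ⟪c, E k l d⟫_ℂ := by
      intro c d k l
      rw [Finset.sum_eq_single k]
      · rw [Finset.sum_eq_single l]
        · simp
        · intro n _ hn
          simp [Pi.single_eq_of_ne hn]
        · simp
      · intro m _ hm
        simp [Pi.single_eq_of_ne hm]
      · simp
    simp only [Pi.add_apply, map_add, inner_add_left, inner_add_right,
        Finset.sum_add_distrib, h1] at hQ
    convert hQ using 1
    ring
  -- Nonnegativity in `ℂ` includes being real. Setting one vector to zero shows the diagonal terms
  -- real, so the off-diagonal imaginary parts cancel.
  have him : ∀ a b : H, (⟪a, E i j b⟫_ℂ).im + (⟪b, E j i a⟫_ℂ).im = 0 := by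
    intro a b
    have h1 := (Complex.le_def.1 (key a b)).2
    have h2 := (Complex.le_def.1 (key a 0)).2
    have h3 := (Complex.le_def.1 (key 0 b)).2
    simp only [map_zero, inner_zero_left, inner_zero_right, add_zero, zero_add,
      Complex.add_im, Complex.zero_im] at h1 h2 h3
    linarith
  refine ContinuousLinearMap.ext fun a => ext_inner_left ℂ fun b => ?_
  rw [ContinuousLinearMap.star_eq_adjoint, ContinuousLinearMap.adjoint_inner_right,
    ← inner_conj_symm]
  have h1 := him a b
  -- Multiplying `a` by `I` turns the statement about imaginary parts into one about real parts.
  have h2 := him (Complex.I • a) b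
  simp only [map_smul, inner_smul_left, inner_smul_right, Complex.conj_I, Complex.mul_im,
      Complex.neg_re, Complex.neg_im, Complex.I_re, Complex.I_im] at h2
  apply Complex.ext
  · simp only [Complex.conj_re]
    linarith
  · simp only [Complex.conj_im]
    linarith

open CFC in
-- Take `b = a⁻`: since `a⁻ a⁺ = 0`, `a⁻ a a⁻ = -(a⁻)³`, and `(a⁻)³ ≥ 0` is some `d^* d`. If `d =
-- 0`, the C*-identity gives `a⁻ = 0`, so `a ≥ 0`. The obstruction to positivity thus becomes an
-- algebraic identity, which can be tested in representations.
theorem IsSelfAdjoint.exists_negPart {D : Type*} [CStarAlgebra D] {a : D} (ha : IsSelfAdjoint a) :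
    ∃ b d : D, star b * a * b = -(star d * d) ∧ (d = 0 → ∃ c, a = star c * c) := by
  let _ : PartialOrder D := CStarAlgebra.spectralOrder D
  have _ : StarOrderedRing D := CStarAlgebra.spectralOrderedRing D
  have hb0 : 0 ≤ a⁻ := negPart_nonneg a
  have hbs : star a⁻ = a⁻ := IsSelfAdjoint.of_nonneg hb0
  have hb3 : 0 ≤ a⁻ * a⁻ * a⁻ := by
    have := star_left_conjugate_nonneg hb0 a⁻
    rwa [hbs] at this
  obtain ⟨d, hd⟩ := CStarAlgebra.nonneg_iff_eq_star_mul_self.1 hb3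
  refine ⟨a⁻, d, ?_, fun hdz => ?_⟩
  · conv_lhs => rw [hbs, ← posPart_sub_negPart a ha]
    rw [← hd, mul_sub, sub_mul, posPart_sub_negPart a ha, negPart_mul_posPart, zero_mul, zero_sub]
  · rw [hdz, mul_zero] at hd
    have hbb : a⁻ * a⁻ = 0 := by
      rw [← CStarRing.star_mul_self_eq_zero_iff, star_mul, hbs, ← mul_assoc, hd, zero_mul]
    have hbz : a⁻ = 0 := by
      rw [← CStarRing.star_mul_self_eq_zero_iff, hbs, hbb]
    exact CStarAlgebra.nonneg_iff_eq_star_mul_self.1 ((negPart_eq_zero_iff a ha).1 hbz)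

/-- If the images of a matrix `e` over a C*-algebra under a separating family of representations
are positive operator matrices, then `e = c^* c` for some matrix `c`. -/
theorem exists_eq_sum_star_mul {C : Type v} [CStarAlgebra C] {J : Type w} {H : J → Type u}
    [∀ j, NormedAddCommGroup (H j)] [∀ j, InnerProductSpace ℂ (H j)] [∀ j, CompleteSpace (H j)]
    (φ : ∀ j, C →⋆ₐ[ℂ] (H j →L[ℂ] H j)) (hφ : ∀ z, (∀ j, φ j z = 0) → z = 0)
    {ι : Type w'} [Fintype ι] (e : ι → ι → C)
    (he : ∀ j, IsPositiveOpMatrix (Matrix.of fun s t => φ j (e s t))) :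
    ∃ c : ι → ι → C, ∀ s t, e s t = ∑ k, star (c k s) * c k t := by
  classical
  let _ : PartialOrder C := CStarAlgebra.spectralOrder C
  have _ : StarOrderedRing C := CStarAlgebra.spectralOrderedRing C
  have hφ' : ∀ z z', (∀ j, φ j z = φ j z') → z = z' := fun z z' h =>
    sub_eq_zero.1 (hφ _ fun j => by rw [map_sub, h, sub_self])
  set a : CStarMatrix ι ι C := CStarMatrix.ofMatrix e with ha
  have hsa : IsSelfAdjoint a := by
    refine CStarMatrix.ext fun s t => hφ' _ _ fun j => ?_
    rw [CStarMatrix.star_apply, map_star]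
    exact (he j).star_entry t s
  obtain ⟨b, d, hbd, hc⟩ := hsa.exists_negPart
  -- In each representation the image of `b^* e b` is positive as a conjugate of a positive matrix,
  -- yet equals minus the image of `d^* d`; so `d` vanishes there, and the family separates points.
  have hdz : d = 0 := by
    refine CStarMatrix.ext fun k s => hφ _ fun j => ?_
    refine eq_zero_of_sum_star_mul_neg (fun k s => φ j (d k s)) ?_ k s
    convert (he j).conj (fun k s => φ j (b k s)) using 1
    ext1 s t
    have h1 : -(star d * d) s t = (star b * a * b) s t := by
      rw [hbd]; rfl
    have h2 := congrArg (φ j) h1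
    simp only [CStarMatrix.mul_apply, CStarMatrix.star_apply, map_neg, map_sum, map_mul,
      map_star, Finset.sum_mul] at h2
    simp only [Matrix.of_apply]
    rw [h2, Finset.sum_comm]
    rfl
  obtain ⟨c, hc⟩ := hc hdz
  refine ⟨fun k s => c k s, fun s t => ?_⟩
  have := congrFun (congrFun hc s) t
  refine Eq.trans this ?_
  simp only [CStarMatrix.mul_apply, CStarMatrix.star_apply]

end Positivity

/-! ### Tensor products of operators -/

section OpTensor

variable {H : Type u} [NormedAddCommGroup H] [InnerProductSpace ℂ H]
variable {K : Type v} [NormedAddCommGroup K] [InnerProductSpace ℂ K]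

theorem HilbertTensor.clm_ext {F : Type*} [NormedAddCommGroup F] [NormedSpace ℂ F]
    {S T : HilbertTensor H K →L[ℂ] F}
    (h : ∀ ξ η, S (HilbertTensor.tmul ξ η) = T (HilbertTensor.tmul ξ η)) : S = T := by
  refine ContinuousLinearMap.ext fun z => ?_
  refine UniformSpace.Completion.induction_on (α := H ⊗[ℂ] K)
    (p := fun z : HilbertTensor H K => S z = T z) z ?_ ?_
  · exact isClosed_eq S.continuous T.continuous
  · intro t
    induction t using TensorProduct.induction_on with
    | zero => exact (map_zero S).trans (map_zero T).symm
    | tmul x y => exact h x y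
    | add x y hx hy =>
      rw [UniformSpace.Completion.coe_add]
      exact (map_add S _ _).trans ((congrArg₂ (· + ·) hx hy).trans (map_add T _ _).symm)

theorem HilbertTensor.add_tmul (ξ ξ' : H) (η : K) :
    tmul (ξ + ξ') η = tmul ξ η + tmul ξ' η :=
  (congrArg _ (TensorProduct.add_tmul ξ ξ' η)).trans (UniformSpace.Completion.coe_add _ _)

theorem HilbertTensor.tmul_add (ξ : H) (η η' : K) :
    tmul ξ (η + η') = tmul ξ η + tmul ξ η' :=
  (congrArg _ (TensorProduct.tmul_add ξ η η')).trans (UniformSpace.Completion.coe_add _ _)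

/-- The tensor product of operators, as a biadditive map. -/
noncomputable def opTensorHom :
    (H →L[ℂ] H) →+ (K →L[ℂ] K) →+ (HilbertTensor H K →L[ℂ] HilbertTensor H K) :=
  AddMonoidHom.mk' (fun S => AddMonoidHom.mk' (fun T => opTensor S T) fun T T' =>
    HilbertTensor.clm_ext fun ξ η => by
      simp only [add_apply, opTensor_tmul, HilbertTensor.tmul_add])
    fun S S' => AddMonoidHom.ext fun T => HilbertTensor.clm_ext fun ξ η => by
      simp only [AddMonoidHom.mk'_apply, AddMonoidHom.add_apply, add_apply,
        opTensor_tmul, HilbertTensor.add_tmul]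

theorem opTensorHom_apply (S : H →L[ℂ] H) (T : K →L[ℂ] K) :
    opTensorHom S T = opTensor S T := rfl

theorem opTensor_sum_left {ι : Type*} (s : Finset ι) (S : ι → H →L[ℂ] H) (T : K →L[ℂ] K) :
    opTensor (∑ i ∈ s, S i) T = ∑ i ∈ s, opTensor (S i) T := by
  simp only [← opTensorHom_apply, map_sum, AddMonoidHom.finsetSum_apply]

theorem opTensor_sum_right {ι : Type*} (s : Finset ι) (S : H →L[ℂ] H) (T : ι → K →L[ℂ] K) :
    opTensor S (∑ i ∈ s, T i) = ∑ i ∈ s, opTensor S (T i) := by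
  simp only [← opTensorHom_apply, map_sum]

theorem opTensor_zero_left (T : K →L[ℂ] K) : opTensor (0 : H →L[ℂ] H) T = 0 := by
  simp only [← opTensorHom_apply, map_zero, AddMonoidHom.zero_apply]

theorem opTensor_zero_right (S : H →L[ℂ] H) : opTensor S (0 : K →L[ℂ] K) = 0 := by
  simp only [← opTensorHom_apply, map_zero]

theorem opTensor_mul (S S' : H →L[ℂ] H) (T T' : K →L[ℂ] K) :
    opTensor S T * opTensor S' T' = opTensor (S * S') (T * T') :=
  HilbertTensor.clm_ext fun ξ η => by
    simp only [mul_apply_eq_comp, opTensor_tmul]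

theorem opTensor_one : opTensor (1 : H →L[ℂ] H) (1 : K →L[ℂ] K) = 1 :=
  HilbertTensor.clm_ext fun ξ η => by
    simp only [opTensor_tmul, one_apply_eq_self]

theorem opTensor_star [CompleteSpace H] [CompleteSpace K] (S : H →L[ℂ] H) (T : K →L[ℂ] K) :
    star (opTensor S T) = opTensor (star S) (star T) := by
  refine HilbertTensor.clm_ext fun ξ η => ?_
  -- Comparing the functionals represented by the two vectors allows the second argument to be an
  -- elementary tensor as well.
  refine (InnerProductSpace.toDual ℂ (HilbertTensor H K)).injective ?_
  refine HilbertTensor.clm_ext fun ξ' η' => ?_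
  simp only [InnerProductSpace.toDual_apply_apply, ContinuousLinearMap.star_eq_adjoint,
    ContinuousLinearMap.adjoint_inner_left, opTensor_tmul, HilbertTensor.inner_tmul]

/-- The squared norm of `S ξ ⊗ T η` is the product of those of `S ξ` and `T η`. -/
theorem opTensor_ne_zero {S : H →L[ℂ] H} {T : K →L[ℂ] K} (hS : S ≠ 0) (hT : T ≠ 0) :
    opTensor S T ≠ 0 := by
  obtain ⟨ξ, hξ⟩ := DFunLike.ne_iff.1 hS
  obtain ⟨η, hη⟩ := DFunLike.ne_iff.1 hT
  intro h
  have h1 : HilbertTensor.tmul (S ξ) (T η) = 0 := by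
    rw [← opTensor_tmul, h]; rfl
  have h2 := HilbertTensor.inner_tmul (S ξ) (S ξ) (T η) (T η)
  rw [h1, inner_zero_left, eq_comm, mul_eq_zero, inner_self_eq_zero, inner_self_eq_zero] at h2
  exact h2.elim hξ hη

end OpTensor

/-! ### Coordinate representations and the universal property -/

section Evaluation

variable {I : Type v} {H : I → Type u} [∀ i, NormedAddCommGroup (H i)]
  [∀ i, InnerProductSpace ℂ (H i)] [∀ i, CompleteSpace (H i)] [∀ i, Nontrivial (H i)]

/-- The coordinate representations of a product of algebras of bounded operators. -/
noncomputable def OpProd.eval (i : I) : OpProd H →⋆ₐ[ℂ] (H i →L[ℂ] H i) where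
  toFun z := z i
  map_one' := rfl
  map_mul' _ _ := rfl
  map_zero' := rfl
  map_add' _ _ := rfl
  commutes' _ := rfl
  map_star' _ := rfl

end Evaluation

/-! ### Generators and universal property of `C_{X,A}` -/

section StochasticAlgebra

variable {X : Type v} {A : Type w} [Fintype A] [DecidableEq X]

/-- The representation of `C_{X,A}` given by a block operator isometry. -/
noncomputable def StochasticCStar.eval (i : BlockIsometry.{u, v, w} X A) :
    StochasticCStar.{u, v, w} X A →⋆ₐ[ℂ] (i.H →L[ℂ] i.H) :=
  (OpProd.eval (H := fun i : BlockIsometry.{u, v, w} X A => i.H) i).comp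
    (stochasticSubalgebra.{u, v, w} X A).subtype

theorem StochasticCStar.eval_gen (i : BlockIsometry.{u, v, w} X A) (x x' : X) (a a' : A) :
    eval i (stochasticGen x x' a a') = ContinuousLinearMap.adjoint (i.V a x) ∘L i.V a' x' := rfl

theorem StochasticCStar.eq_zero_of_eval {z : StochasticCStar.{u, v, w} X A}
    (h : ∀ i, eval i z = 0) : z = 0 :=
  Subtype.ext (Subtype.ext (funext h))

theorem StochasticCStar.sum_gen (x x' : X) :
    ∑ a, stochasticGen.{u, v, w} x x' a a
      = if x = x' then (1 : StochasticCStar.{u, v, w} X A) else 0 := by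
  refine sub_eq_zero.1 (eq_zero_of_eval fun i => ?_)
  rw [map_sub, map_sum]
  simp only [eval_gen, i.isometry]
  split_ifs <;> simp

/-- The factorisation `v_{a,x}^* v_{a',x'}` has its factors in the TRO, where a representation of
`C_{X,A}` is not defined. It shows positivity in each coordinate, the quadratic form being `‖∑
V_{a,x} ξ_{x,a}‖²`, and this yields factors in `C_{X,A}` itself. -/
theorem StochasticCStar.exists_gen_eq_sum_star_mul [Fintype X] :
    ∃ c : X × A → X × A → StochasticCStar.{u, v, w} X A, ∀ s t,
      stochasticGen s.1 t.1 s.2 t.2 = ∑ k, star (c k s) * c k t := by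
  refine exists_eq_sum_star_mul eval (fun _ => eq_zero_of_eval) _ fun i ξ => ?_
  have key : ∑ s, ∑ t, ⟪ξ s, eval i (stochasticGen s.1 t.1 s.2 t.2) (ξ t)⟫_ℂ
      = ⟪∑ s, i.V s.2 s.1 (ξ s), ∑ s, i.V s.2 s.1 (ξ s)⟫_ℂ := by
    simp only [eval_gen, ContinuousLinearMap.comp_apply,
      ContinuousLinearMap.adjoint_inner_right, sum_inner, inner_sum]
    exact Finset.sum_comm
  refine le_of_le_of_eq ?_ key.symm
  rw [inner_self_eq_norm_sq_to_K]
  simp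

/-- Compression-inflation along an isometry, as a `*`-homomorphism. -/
noncomputable def conjIsometryHom {L M : Type*} [NormedAddCommGroup L] [InnerProductSpace ℂ L]
    [CompleteSpace L] [NormedAddCommGroup M] [InnerProductSpace ℂ M] [CompleteSpace M]
    (ι : L →L[ℂ] M) (hι : ContinuousLinearMap.adjoint ι ∘L ι = 1) :
    (L →L[ℂ] L) →⋆ₙₐ[ℂ] (M →L[ℂ] M) where
  toFun T := ι ∘L T ∘L ContinuousLinearMap.adjoint ι
  map_smul' c T := by ext; simp
  map_zero' := by ext; simp
  map_add' S T := by ext; simp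
  map_mul' S T := by
    ext ξ
    have h : ∀ η, ContinuousLinearMap.adjoint ι (ι η) = η := fun η =>
      congrArg (fun T : L →L[ℂ] L => T η) hι
    simp [h]
  map_star' T := by
    simp only [ContinuousLinearMap.star_eq_adjoint, ContinuousLinearMap.adjoint_comp,
      ContinuousLinearMap.adjoint_adjoint, ContinuousLinearMap.comp_assoc]

/-- The universal property of `C_{X,A}`, for representations whose unit is a given projection. -/
theorem StochasticCStar.exists_rep {M : Type u} [NormedAddCommGroup M] [InnerProductSpace ℂ M]
    [CompleteSpace M] {p : M →L[ℂ] M} (hp0 : p ≠ 0) (hpp : p * p = p) (hps : star p = p)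
    {κ : Type*} [Fintype κ] (G : κ → A → X → M →L[ℂ] M) (hGp : ∀ k a x, G k a x * p = G k a x)
    (hG : ∀ x x', ∑ a, ∑ k, star (G k a x) * G k a x' = if x = x' then p else 0) :
    ∃ π : StochasticCStar.{u, v, w} X A →⋆ₙₐ[ℂ] (M →L[ℂ] M), π 1 = p ∧
      ∀ x x' a a', π (stochasticGen x x' a a') = ∑ k, star (G k a x) * G k a' x' := by
  -- `L` is the range of `p`; it is non-zero because `p` is, as a block isometry requires of its
  -- domain.
  let L : Submodule ℂ M := (1 - p).ker
  have hL : ∀ ξ, ξ ∈ L ↔ p ξ = ξ := fun ξ => by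
    rw [LinearMap.mem_ker, ContinuousLinearMap.coe_coe, sub_apply, one_apply_eq_self,
      sub_eq_zero, eq_comm]
  have hLp : ∀ ξ, p ξ ∈ L := fun ξ => (hL _).2 (congrArg (fun T : M →L[ℂ] M => T ξ) hpp)
  have : CompleteSpace L := (1 - p).isClosed_ker.completeSpace_coe
  have : Nontrivial L := by
    obtain ⟨ξ, hξ⟩ := DFunLike.ne_iff.1 hp0
    exact ⟨⟨⟨p ξ, hLp ξ⟩, 0, fun h => hξ (congrArg Subtype.val h)⟩⟩
  let ι : L →L[ℂ] M := L.subtypeL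
  have hι : ContinuousLinearMap.adjoint ι ∘L ι = 1 := by
    refine ContinuousLinearMap.ext fun ξ => ext_inner_left ℂ fun η => ?_
    rw [ContinuousLinearMap.comp_apply, ContinuousLinearMap.adjoint_inner_right]
    rfl
  -- Taking adjoints in `p ι = ι` gives `ι^* p = ι^*`, so `ι^* ξ` is `p ξ` viewed in `L`.
  have hpι : ι ∘L ContinuousLinearMap.adjoint ι = p := by
    have h1 : p ∘L ι = ι := ContinuousLinearMap.ext fun ξ => (hL _).1 ξ.2
    have h2 : ContinuousLinearMap.adjoint ι ∘L p = ContinuousLinearMap.adjoint ι := by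
      conv_rhs => rw [← h1, ContinuousLinearMap.adjoint_comp,
        ← ContinuousLinearMap.star_eq_adjoint p, hps]
    have h3 : ∀ ξ, ContinuousLinearMap.adjoint ι ξ = ⟨p ξ, hLp ξ⟩ := fun ξ => by
      conv_lhs => rw [← h2]
      exact congrArg (fun T : L →L[ℂ] L => T ⟨p ξ, hLp ξ⟩) hι
    ext ξ
    rw [ContinuousLinearMap.comp_apply, h3]
    rfl
  -- The operators `G k a x`, restricted to `L`, are stacked over `k`, so that `V^* V` becomes the
  -- compression of `∑ k, G^* G`. Indexing by `Fin` keeps the codomain in the universe of `M`.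
  let V : A → X → L →L[ℂ] PiLp 2 (fun _ : Fin (Fintype.card κ) => M) := fun a x =>
    (PiLp.continuousLinearEquiv 2 ℂ (fun _ : Fin (Fintype.card κ) => M)).symm.toContinuousLinearMap
      ∘L ContinuousLinearMap.pi fun k => G ((Fintype.equivFin κ).symm k) a x ∘L ι
  have hV : ∀ a x a' x', ContinuousLinearMap.adjoint (V a x) ∘L V a' x'
      = ContinuousLinearMap.adjoint ι ∘L (∑ k, star (G k a x) * G k a' x') ∘L ι := by
    intro a x a' x'
    refine ContinuousLinearMap.ext fun ξ => ext_inner_left ℂ fun η => ?_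
    simp only [ContinuousLinearMap.comp_apply, ContinuousLinearMap.adjoint_inner_right,
      PiLp.inner_apply, sum_apply, inner_sum, mul_apply_eq_comp,
      ContinuousLinearMap.star_eq_adjoint]
    exact (Fintype.equivFin κ).symm.sum_comp fun k => ⟪G k a x (ι η), G k a' x' (ι ξ)⟫_ℂ
  let i : BlockIsometry.{u, v, w} X A :=
    { H := L
      K := PiLp 2 (fun _ : Fin (Fintype.card κ) => M)
      V := V
      isometry := fun x x' => by
        have h : ∑ a, ContinuousLinearMap.adjoint ι ∘L (∑ k, star (G k a x) * G k a x') ∘L ι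
            = ContinuousLinearMap.adjoint ι ∘L
              (∑ a, ∑ k, star (G k a x) * G k a x') ∘L ι := by
          ext ξ
          simp only [sum_apply, ContinuousLinearMap.comp_apply, map_sum]
        simp only [hV]
        rw [h, hG]
        split_ifs
        · rw [← hpι, ContinuousLinearMap.comp_assoc, hι, ← ContinuousLinearMap.comp_assoc, hι]
          rfl
        · rw [ContinuousLinearMap.zero_comp, ContinuousLinearMap.comp_zero] }
  -- Evaluation at `i` acts unitally on `L`; `T ↦ ι T ι^*` extends it by zero to `M`, sending the
  -- unit to `ι ι^* = p`.
  refine ⟨(conjIsometryHom ι hι).comp (eval i : _ →⋆ₙₐ[ℂ] _), ?_, fun x x' a a' => ?_⟩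
  · change ι ∘L (eval i 1) ∘L ContinuousLinearMap.adjoint ι = p
    rw [map_one]
    exact hpι
  · change ι ∘L (ContinuousLinearMap.adjoint (V a x) ∘L V a' x') ∘L
      ContinuousLinearMap.adjoint ι = _
    rw [hV]
    -- Since `G p = G`, the sums `∑ k, G^* G` are unchanged by `p` on either side, and compression
    -- to `L` loses nothing.
    have h1 : (∑ k, star (G k a x) * G k a' x') * p = ∑ k, star (G k a x) * G k a' x' := by
      simp only [Finset.sum_mul, mul_assoc, hGp]
    have h2 : p * (∑ k, star (G k a x) * G k a' x') = ∑ k, star (G k a x) * G k a' x' := by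
      have h3 : ∀ k, p * star (G k a x) = star (G k a x) := fun k => by
        conv_rhs => rw [← hGp k a x, star_mul, hps]
      simp only [Finset.mul_sum, ← mul_assoc, h3]
    calc _ = (ι ∘L ContinuousLinearMap.adjoint ι) * (∑ k, star (G k a x) * G k a' x')
          * (ι ∘L ContinuousLinearMap.adjoint ι) := rfl
      _ = _ := by rw [hpι, h2, h1]

end StochasticAlgebra

/-! ### Factorisation and relations of the generators of `C_{XY,AB}` -/

section StrongAlgebra

variable {X : Type v} {Y : Type v'} {A : Type w} {B : Type w'}
  [Fintype X] [Fintype Y] [Fintype A] [Fintype B] [DecidableEq X] [DecidableEq Y]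

/-- The representation of `C_{XY,AB}` given by a representation of its defining relations. -/
noncomputable def StrongCStar.eval (i : StrongRelationsRep.{u, v, w, v', w'} X Y A B) :
    StrongCStar.{u, v, w, v', w'} X Y A B →⋆ₐ[ℂ] (i.H →L[ℂ] i.H) :=
  (OpProd.eval (H := fun i : StrongRelationsRep.{u, v, w, v', w'} X Y A B => i.H) i).comp
    (strongSubalgebra.{u, v, w, v', w'} X Y A B).subtype

theorem StrongCStar.eval_gen (i : StrongRelationsRep.{u, v, w, v', w'} X Y A B)
    (x x' : X) (y y' : Y) (a a' : A) (b b' : B) :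
    eval i (strongGen x x' y y' a a' b b') = i.P x x' y y' a a' b b' := rfl

theorem StrongCStar.eq_zero_of_eval {z : StrongCStar.{u, v, w, v', w'} X Y A B}
    (h : ∀ i, eval i z = 0) : z = 0 :=
  Subtype.ext (Subtype.ext (funext h))

theorem StrongCStar.eq_of_eval {z z' : StrongCStar.{u, v, w, v', w'} X Y A B}
    (h : ∀ i, eval i z = eval i z') : z = z' :=
  Subtype.ext (Subtype.ext (funext h))

theorem StrongCStar.exists_gen_eq_sum_star_mul :
    ∃ c : (X × Y) × (A × B) → (X × Y) × (A × B) → StrongCStar.{u, v, w, v', w'} X Y A B, ∀ s t,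
      strongGen s.1.1 t.1.1 s.1.2 t.1.2 s.2.1 t.2.1 s.2.2 t.2.2 = ∑ k, star (c k s) * c k t :=
  exists_eq_sum_star_mul eval (fun _ => eq_zero_of_eval) _ fun i => i.positive

theorem StrongCStar.sum_fst_eq (x x' : X) (y y' : Y) (b b' : B) :
    ∑ a : A, strongGen.{u} x x y y' a a b b' = ∑ a, strongGen x' x' y y' a a b b' :=
  eq_of_eval fun i => by
    simpa only [map_sum, eval_gen] using i.rel_one x x' y y' b b'

theorem StrongCStar.sum_fst_eq_zero {x x' : X} (h : x ≠ x') (y y' : Y) (b b' : B) :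
    ∑ a : A, strongGen.{u} x x' y y' a a b b' = 0 :=
  eq_of_eval fun i => by
    simpa only [map_sum, eval_gen, map_zero] using i.rel_two x x' y y' b b' h

theorem StrongCStar.sum_snd_eq (x x' : X) (y y' : Y) (a a' : A) :
    ∑ b : B, strongGen.{u} x x' y y a a' b b = ∑ b, strongGen x x' y' y' a a' b b :=
  eq_of_eval fun i => by
    simpa only [map_sum, eval_gen] using i.rel_three x x' y y' a a'

theorem StrongCStar.sum_snd_eq_zero (x x' : X) {y y' : Y} (h : y ≠ y') (a a' : A) :
    ∑ b : B, strongGen.{u} x x' y y' a a' b b = 0 :=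
  eq_of_eval fun i => by
    simpa only [map_sum, eval_gen, map_zero] using i.rel_four x x' y y' a a' h

theorem StrongCStar.sum_sum_gen (x x' : X) (y y' : Y) :
    ∑ a : A, ∑ b : B, strongGen.{u} x x' y y' a a b b = if x = x' ∧ y = y' then 1 else 0 :=
  eq_of_eval fun i => by
    simp only [map_sum, eval_gen, i.rel_five]
    split_ifs <;> simp

end StrongAlgebra

/-! ### Slices of positive operator matrices -/

section Slices

variable {H : Type u} [NormedAddCommGroup H] [InnerProductSpace ℂ H]

theorem IsPositiveOpMatrix.finset_sum {ι κ : Type*} [Fintype ι] (s : Finset κ)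
    {E : κ → Matrix ι ι (H →L[ℂ] H)} (hE : ∀ k ∈ s, IsPositiveOpMatrix (E k)) :
    IsPositiveOpMatrix (∑ k ∈ s, E k) := by
  intro ξ
  have key : ∑ i, ∑ j, ⟪ξ i, (∑ k ∈ s, E k) i j (ξ j)⟫_ℂ
      = ∑ k ∈ s, ∑ i, ∑ j, ⟪ξ i, E k i j (ξ j)⟫_ℂ := by
    simp only [Matrix.sum_apply, sum_apply, inner_sum]
    rw [Finset.sum_comm]
    refine (Finset.sum_congr rfl fun j _ => Finset.sum_comm).trans ?_
    rw [Finset.sum_comm]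
    exact Finset.sum_congr rfl fun k _ => Finset.sum_comm
  rw [key]
  exact Finset.sum_nonneg fun k hk => hE k hk ξ

/-- This is conjugation by the 0-1 matrix of `f`, which need not be injective. -/
theorem IsPositiveOpMatrix.submatrix [CompleteSpace H] {ι κ : Type*} [Fintype ι] [Fintype κ]
    {E : Matrix ι ι (H →L[ℂ] H)} (hE : IsPositiveOpMatrix E) (f : κ → ι) :
    IsPositiveOpMatrix (E.submatrix f f) := by
  classical
  convert hE.conj (fun i k => if i = f k then 1 else 0) using 1
  ext1 k l
  simp [apply_ite star]

theorem IsPositiveOpMatrix.slice [CompleteSpace H] {ι κ μ : Type*} [Fintype ι] [Fintype κ]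
    [Fintype μ] {E : Matrix ι ι (H →L[ℂ] H)} (hE : IsPositiveOpMatrix E) (f : κ → μ → ι)
    (z : μ → ℂ) :
    IsPositiveOpMatrix
      (Matrix.of fun k l => ∑ m, ∑ n, (z n * star (z m)) • E (f k m) (f l n)) := by
  intro ξ
  -- The test vector is `ξ ⊗ z`; conjugate linearity in the first argument puts the `star` on the
  -- row index `m`.
  have h := hE.submatrix (fun q : κ × μ => f q.1 q.2) fun q => z q.2 • ξ q.1
  convert h using 1
  simp only [Fintype.sum_prod_type, Matrix.of_apply, sum_apply, smul_apply, inner_sum,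
    inner_smul_left, inner_smul_right, map_smul, Matrix.submatrix_apply]
  refine Finset.sum_congr rfl fun k _ => ?_
  rw [Finset.sum_comm]
  refine Finset.sum_congr rfl fun m _ => Finset.sum_congr rfl fun l _ =>
    Finset.sum_congr rfl fun n _ => ?_
  rw [starRingEnd_apply]
  ring

theorem IsPureStateMatrix.trace_eq_one {X : Type*} [Fintype X] {σ : Matrix X X ℂ}
    (hσ : IsPureStateMatrix σ) : ∑ x, σ x x = 1 := by
  obtain ⟨ξ, hξ, rfl⟩ := hσ
  have h := EuclideanSpace.norm_sq_eq ξ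
  rw [hξ, one_pow] at h
  have h1 : ∀ x, ξ x * star (ξ x) = ((‖ξ x‖ ^ 2 : ℝ) : ℂ) := fun x => by
    rw [Complex.ofReal_pow]
    exact Complex.mul_conj' (ξ x)
  simp only [Matrix.of_apply, h1]
  rw [← Complex.ofReal_sum, ← h, Complex.ofReal_one]

theorem IsPureStateMatrix.nonempty {X : Type*} [Fintype X] {σ : Matrix X X ℂ}
    (hσ : IsPureStateMatrix σ) : Nonempty X := by
  by_contra h
  rw [not_nonempty_iff] at h
  simpa using hσ.trace_eq_one

/-- `Q` is diagonal with a constant entry, so `σ` enters only through its trace. This is why the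
marginals do not depend on the state. -/
theorem sum_sum_smul_eq_of_diagonal {Y M : Type*} [Fintype Y] [AddCommGroup M] [Module ℂ M]
    (σ : Matrix Y Y ℂ) (hσ : ∑ y, σ y y = 1) (Q : Y → Y → M) (h0 : ∀ y y', y ≠ y' → Q y y' = 0)
    (h1 : ∀ y y', Q y y = Q y' y') (y₀ : Y) : ∑ y, ∑ y', σ y' y • Q y y' = Q y₀ y₀ := by
  have h : ∀ y, ∑ y', σ y' y • Q y y' = σ y y • Q y₀ y₀ := fun y => by
    rw [Finset.sum_eq_single y, h1 y y₀]
    · intro y' _ hy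
      rw [h0 y y' hy.symm, smul_zero]
    · simp
  simp only [h, ← Finset.sum_smul, hσ, one_smul]

variable {X : Type v} {A : Type w} {Y : Type v'} {B : Type w'}

section

variable [Fintype X] [Fintype A] [Fintype Y] [Fintype B]

theorem IsPositiveOpMatrix.traceSliceRight [CompleteSpace H]
    {P : Matrix ((X × Y) × (A × B)) ((X × Y) × (A × B)) (H →L[ℂ] H)}
    (hP : IsPositiveOpMatrix P) {σ : Matrix Y Y ℂ} (hσ : IsPureStateMatrix σ) :
    IsPositiveOpMatrix (traceSliceRight σ P) := by
  obtain ⟨ξ, -, rfl⟩ := hσ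
  convert IsPositiveOpMatrix.finset_sum Finset.univ fun b _ =>
    hP.slice (fun (s : X × A) y => ((s.1, y), (s.2, b))) ξ using 1
  ext1 s t
  simp [_root_.traceSliceRight, Matrix.sum_apply]

theorem IsPositiveOpMatrix.traceSliceLeft [CompleteSpace H]
    {P : Matrix ((X × Y) × (A × B)) ((X × Y) × (A × B)) (H →L[ℂ] H)}
    (hP : IsPositiveOpMatrix P) {σ : Matrix X X ℂ} (hσ : IsPureStateMatrix σ) :
    IsPositiveOpMatrix (traceSliceLeft σ P) := by
  obtain ⟨ξ, -, rfl⟩ := hσ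
  convert IsPositiveOpMatrix.finset_sum Finset.univ fun a _ =>
    hP.slice (fun (s : Y × B) x => ((x, s.1), (a, s.2))) ξ using 1
  ext1 s t
  simp [_root_.traceSliceLeft, Matrix.sum_apply]

end

/-- The hypotheses say that the `B`-trace of `P` has the form `I_Y ⊗ Q`; a state returns `Q`, which
can be read off at any `y`. -/
theorem traceSliceRight_eq [Fintype Y] [Fintype B]
    {P : Matrix ((X × Y) × (A × B)) ((X × Y) × (A × B)) (H →L[ℂ] H)}
    (h1 : ∀ x x' y y' a a', ∑ b, P ((x, y), (a, b)) ((x', y), (a', b))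
      = ∑ b, P ((x, y'), (a, b)) ((x', y'), (a', b)))
    (h0 : ∀ x x' y y' a a', y ≠ y' → ∑ b, P ((x, y), (a, b)) ((x', y'), (a', b)) = 0)
    {σ : Matrix Y Y ℂ} (hσ : IsPureStateMatrix σ) (y : Y) :
    traceSliceRight σ P =
      Matrix.of fun s t => ∑ b, P ((s.1, y), (s.2, b)) ((t.1, y), (t.2, b)) := by
  ext1 s t
  rw [Matrix.of_apply, ← sum_sum_smul_eq_of_diagonal σ hσ.trace_eq_one
    (fun y y' => ∑ b, P ((s.1, y), (s.2, b)) ((t.1, y'), (t.2, b)))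
    (fun y y' => h0 _ _ y y' _ _) (fun y y' => h1 _ _ y y' _ _) y]
  simp only [traceSliceRight, Matrix.of_apply, Finset.smul_sum]
  rw [Finset.sum_comm]
  exact Finset.sum_congr rfl fun y _ => Finset.sum_comm

theorem traceSliceLeft_eq [Fintype X] [Fintype A]
    {P : Matrix ((X × Y) × (A × B)) ((X × Y) × (A × B)) (H →L[ℂ] H)}
    (h1 : ∀ x x' y y' b b', ∑ a, P ((x, y), (a, b)) ((x, y'), (a, b'))
      = ∑ a, P ((x', y), (a, b)) ((x', y'), (a, b')))
    (h0 : ∀ x x' y y' b b', x ≠ x' → ∑ a, P ((x, y), (a, b)) ((x', y'), (a, b')) = 0)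
    {σ : Matrix X X ℂ} (hσ : IsPureStateMatrix σ) (x : X) :
    traceSliceLeft σ P =
      Matrix.of fun s t => ∑ a, P ((x, s.1), (a, s.2)) ((x, t.1), (a, t.2)) := by
  ext1 s t
  rw [Matrix.of_apply, ← sum_sum_smul_eq_of_diagonal σ hσ.trace_eq_one
    (fun x x' => ∑ a, P ((x, s.1), (a, s.2)) ((x', t.1), (a, t.2)))
    (fun x x' => h0 x x' _ _ _ _) (fun x x' => h1 x x' _ _ _ _) x]
  simp only [traceSliceLeft, Matrix.of_apply, Finset.smul_sum]
  rw [Finset.sum_comm]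
  exact Finset.sum_congr rfl fun y _ => Finset.sum_comm

/-- The first four relations reduce each sliced marginal to its value at a base point, which exists
because a pure state forces a nonempty index set. The fifth relation then computes the partial
traces. -/
theorem IsStronglyStochasticOpMatrix.of_relations [Fintype X] [Fintype A]
    [Fintype Y] [Fintype B] [CompleteSpace H] [DecidableEq X] [DecidableEq Y]
    {P : Matrix ((X × Y) × (A × B)) ((X × Y) × (A × B)) (H →L[ℂ] H)}
    (hP : IsPositiveOpMatrix P)
    (h1 : ∀ x x' y y' b b', ∑ a, P ((x, y), (a, b)) ((x, y'), (a, b'))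
      = ∑ a, P ((x', y), (a, b)) ((x', y'), (a, b')))
    (h2 : ∀ x x' y y' b b', x ≠ x' → ∑ a, P ((x, y), (a, b)) ((x', y'), (a, b')) = 0)
    (h3 : ∀ x x' y y' a a', ∑ b, P ((x, y), (a, b)) ((x', y), (a', b))
      = ∑ b, P ((x, y'), (a, b)) ((x', y'), (a', b)))
    (h4 : ∀ x x' y y' a a', y ≠ y' → ∑ b, P ((x, y), (a, b)) ((x', y'), (a', b)) = 0)
    (h5 : ∀ x x' y y', ∑ a, ∑ b, P ((x, y), (a, b)) ((x', y'), (a, b))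
      = if x = x' ∧ y = y' then 1 else 0) :
    IsStronglyStochasticOpMatrix P where
  stochastic := by
    refine ⟨hP, ?_⟩
    ext1 ⟨x, y⟩ ⟨x', y'⟩
    simp only [opPartialTrace, Matrix.of_apply, Fintype.sum_prod_type, h5, Matrix.one_apply,
      Prod.mk.injEq]
  right_stochastic σ hσ := by
    obtain ⟨y⟩ := hσ.nonempty
    refine ⟨hP.traceSliceRight hσ, ?_⟩
    rw [traceSliceRight_eq h3 h4 hσ y]
    ext1 x x'
    simp only [opPartialTrace, Matrix.of_apply, h5, Matrix.one_apply, and_true]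
  right_eq σ σ' hσ hσ' := by
    obtain ⟨y⟩ := hσ.nonempty
    rw [traceSliceRight_eq h3 h4 hσ y, traceSliceRight_eq h3 h4 hσ' y]
  left_stochastic σ hσ := by
    obtain ⟨x⟩ := hσ.nonempty
    refine ⟨hP.traceSliceLeft hσ, ?_⟩
    rw [traceSliceLeft_eq h1 h2 hσ x]
    ext1 y y'
    simp only [opPartialTrace, Matrix.of_apply, Matrix.one_apply]
    rw [Finset.sum_comm, h5]
    simp only [true_and]
  left_eq σ σ' hσ hσ' := by
    obtain ⟨x⟩ := hσ.nonempty
    rw [traceSliceLeft_eq h1 h2 hσ x, traceSliceLeft_eq h1 h2 hσ' x]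

end Slices

/-! ### Representations and the main result -/

/-- Because `φ z = φ 1 * φ z`, the image of the unit controls `φ` even when `φ` is not unital. -/
theorem map_one_ne_zero_of_ne_zero {C D : Type*} [CStarAlgebra C] [CStarAlgebra D]
    {φ : C →⋆ₙₐ[ℂ] D} (hφ : φ ≠ 0) : φ 1 ≠ 0 := by
  intro h
  refine hφ (NonUnitalStarAlgHom.ext fun z => ?_)
  rw [← one_mul z, map_mul, h, zero_mul]
  rfl

/-- For empty `A` the trace relation reads `0 = 1` in `C_{X,A}`. The conclusion supplies the base
point of `A₁` used in `sum_sliceJ`. -/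
theorem StochasticCStar.nonempty_of_rep_ne_zero {X : Type v} {A : Type w} [Fintype A]
    [DecidableEq X] [Nonempty X] {D : Type*} [CStarAlgebra D]
    {π : StochasticCStar.{u, v, w} X A →⋆ₙₐ[ℂ] D} (hπ : π ≠ 0) : Nonempty A := by
  by_contra h
  rw [not_nonempty_iff] at h
  obtain ⟨x⟩ := ‹Nonempty X›
  have h1 := sum_gen.{u} (A := A) x x
  rw [Finset.univ_eq_empty, Finset.sum_empty, if_pos rfl] at h1
  refine map_one_ne_zero_of_ne_zero hπ ?_
  rw [← h1, map_zero]

/-! ### Partial trace and Gram factorisation of the slice `F` -/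

section Main

variable {X₁ : Type v} {X₂ : Type v'} {A₁ : Type w} {A₂ : Type w'}
  [Fintype X₁] [Fintype A₁]
  {H : Type*} [NormedAddCommGroup H] [InnerProductSpace ℂ H] [CompleteSpace H]
  {K : Type*} [NormedAddCommGroup K] [InnerProductSpace ℂ K] [CompleteSpace K]

/-- Summing `p` over `A₂` kills the terms with `a₁ ≠ a₁'` and makes the others independent of `a₁`.
The sum over `A₁` then falls on `e` alone and gives `δ_{x₁ x₁'} 1`. What remains is the total trace
of `p` over `X₁` and `A₂`, fixed by the last relation. -/
theorem sum_sliceJ [Fintype X₂] [Fintype A₂] [DecidableEq X₁] [DecidableEq X₂] [DecidableEq A₁]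
    [Nonempty A₁] (π : StochasticCStar.{u, v, w} X₁ A₁ →⋆ₙₐ[ℂ] (H →L[ℂ] H))
    (ρ : StrongCStar.{u} X₂ A₁ X₁ A₂ →⋆ₙₐ[ℂ] (K →L[ℂ] K)) (x x' : X₂) :
    ∑ a, sliceJ (Matrix.of fun s t => π (stochasticGen s.1 t.1 s.2 t.2))
      (Matrix.of fun s t => ρ (strongGen s.1.1 t.1.1 s.1.2 t.1.2 s.2.1 t.2.1 s.2.2 t.2.2))
      (x, a) (x', a) = if x = x' then opTensor (π 1) (ρ 1) else 0 := by
  obtain ⟨y₀⟩ := ‹Nonempty A₁›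
  simp only [sliceJ, Matrix.of_apply]
  have h1 : ∀ z z' y y', ∑ a, opTensor (π (stochasticGen z z' y y'))
      (ρ (strongGen x x' y y' z z' a a)) = if y = y' then
        opTensor (π (stochasticGen z z' y y')) (ρ (∑ a, strongGen x x' y₀ y₀ z z' a a)) else 0 := by
    intro z z' y y'
    rw [← opTensor_sum_right, ← map_sum]
    split_ifs with h
    · subst h
      rw [StrongCStar.sum_snd_eq x x' y y₀]
    · rw [StrongCStar.sum_snd_eq_zero x x' h, map_zero, opTensor_zero_right]
  calc _ = ∑ z, ∑ z', ∑ y, ∑ y', ∑ a, opTensor (π (stochasticGen z z' y y'))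
          (ρ (strongGen x x' y y' z z' a a)) := by
        rw [Finset.sum_comm]
        refine Finset.sum_congr rfl fun z _ => ?_
        rw [Finset.sum_comm]
        refine Finset.sum_congr rfl fun z' _ => ?_
        rw [Finset.sum_comm]
        exact Finset.sum_congr rfl fun y _ => Finset.sum_comm
    _ = ∑ z, ∑ z', opTensor (π (∑ y, stochasticGen z z' y y))
          (ρ (∑ a, strongGen x x' y₀ y₀ z z' a a)) := by
        simp only [h1, Finset.sum_ite_eq, Finset.mem_univ, if_true, map_sum π,
          opTensor_sum_left]
    _ = ∑ z, opTensor (π 1) (ρ (∑ a, strongGen x x' y₀ y₀ z z a a)) := by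
        refine Finset.sum_congr rfl fun z _ => ?_
        rw [Finset.sum_eq_single z]
        · rw [StochasticCStar.sum_gen, if_pos rfl]
        · intro z' _ hz
          rw [StochasticCStar.sum_gen, if_neg hz.symm, map_zero, opTensor_zero_left]
        · simp
    _ = if x = x' then opTensor (π 1) (ρ 1) else 0 := by
        rw [← opTensor_sum_right, ← map_sum, StrongCStar.sum_sum_gen]
        simp only [and_true]
        split_ifs
        · rfl
        · rw [map_zero, opTensor_zero_right]

/-- The slice of `E ⊗ P` is of the form `G^* G` when `E = c^* c` and `P = d^* d`. -/
theorem sliceJ_eq_sum_star_mul {κ κ' : Type*} [Fintype κ] [Fintype κ']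
    {E : Matrix (X₁ × A₁) (X₁ × A₁) (H →L[ℂ] H)}
    {P : Matrix ((X₂ × A₁) × (X₁ × A₂)) ((X₂ × A₁) × (X₁ × A₂)) (K →L[ℂ] K)}
    {c : κ → X₁ × A₁ → H →L[ℂ] H} {d : κ' → (X₂ × A₁) × (X₁ × A₂) → K →L[ℂ] K}
    (hE : ∀ s t, E s t = ∑ k, star (c k s) * c k t)
    (hP : ∀ s t, P s t = ∑ k, star (d k s) * d k t) (s t : X₂ × A₂) :
    sliceJ E P s t = ∑ k : κ × κ',
      star (∑ r : X₁ × A₁, opTensor (c k.1 r) (d k.2 ((s.1, r.2), (r.1, s.2)))) *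
        ∑ r : X₁ × A₁, opTensor (c k.1 r) (d k.2 ((t.1, r.2), (r.1, t.2))) := by
  calc _ = ∑ r : X₁ × A₁, ∑ r' : X₁ × A₁, opTensor (E r r')
        (P ((s.1, r.2), (r.1, s.2)) ((t.1, r'.2), (r'.1, t.2))) := by
        simp only [sliceJ, Matrix.of_apply, Fintype.sum_prod_type]
        exact Finset.sum_congr rfl fun x _ => Finset.sum_comm
    -- By bilinearity and `(S ⊗ T)^* (S' ⊗ T') = S^* S' ⊗ T^* T'`, the inner indices of the two
    -- factorisations combine into one pair `k`.
    _ = ∑ r : X₁ × A₁, ∑ r' : X₁ × A₁, ∑ k : κ × κ',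
        star (opTensor (c k.1 r) (d k.2 ((s.1, r.2), (r.1, s.2)))) *
          opTensor (c k.1 r') (d k.2 ((t.1, r'.2), (r'.1, t.2))) := by
        simp only [hE, hP, opTensor_sum_left, opTensor_sum_right, opTensor_star, opTensor_mul,
          Fintype.sum_prod_type (α₁ := κ)]
        exact Finset.sum_congr rfl fun r _ => Finset.sum_congr rfl fun r' _ => Finset.sum_comm
    _ = _ := by
        simp only [star_sum, Finset.sum_mul, Finset.mul_sum]
        calc _ = ∑ r : X₁ × A₁, ∑ k : κ × κ', ∑ r' : X₁ × A₁,
              star (opTensor (c k.1 r) (d k.2 ((s.1, r.2), (r.1, s.2)))) *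
                opTensor (c k.1 r') (d k.2 ((t.1, r'.2), (r'.1, t.2))) :=
              Finset.sum_congr rfl fun r _ => Finset.sum_comm
          _ = ∑ k : κ × κ', ∑ r : X₁ × A₁, ∑ r' : X₁ × A₁,
              star (opTensor (c k.1 r) (d k.2 ((s.1, r.2), (r.1, s.2)))) *
                opTensor (c k.1 r') (d k.2 ((t.1, r'.2), (r'.1, t.2))) := Finset.sum_comm
          _ = _ := Finset.sum_congr rfl fun k _ => Finset.sum_comm

end Main

theorem mainTheorem12 {X₁ X₂ A₁ A₂ : Type*}
    [Fintype X₁] [Fintype X₂] [Fintype A₁] [Fintype A₂]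
    [DecidableEq X₁] [DecidableEq X₂] [DecidableEq A₁]
    [Nonempty X₁] [Nonempty X₂]
    {H : Type u} [NormedAddCommGroup H] [InnerProductSpace ℂ H] [CompleteSpace H]
    {K : Type u} [NormedAddCommGroup K] [InnerProductSpace ℂ K] [CompleteSpace K]
    (π : StochasticCStar.{u} X₁ A₁ →⋆ₙₐ[ℂ] (H →L[ℂ] H)) (hπ : π ≠ 0)
    (ρ : StrongCStar.{u} X₂ A₁ X₁ A₂ →⋆ₙₐ[ℂ] (K →L[ℂ] K)) (hρ : ρ ≠ 0)
    (E : Matrix (X₁ × A₁) (X₁ × A₁) (H →L[ℂ] H))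
    (hE : E = Matrix.of fun s t => π (stochasticGen s.1 t.1 s.2 t.2))
    (P : Matrix ((X₂ × A₁) × (X₁ × A₂)) ((X₂ × A₁) × (X₁ × A₂)) (K →L[ℂ] K))
    (hP : P = Matrix.of fun s t =>
      ρ (strongGen s.1.1 t.1.1 s.1.2 t.1.2 s.2.1 t.2.1 s.2.2 t.2.2)) :
    (π 1 = 1 → IsStochasticOpMatrix E) ∧
    (ρ 1 = 1 → IsStronglyStochasticOpMatrix P) ∧
    (π 1 = 1 → ρ 1 = 1 → IsStochasticOpMatrix (sliceJ E P)) ∧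
    ∃ π' : StochasticCStar.{u} X₂ A₂ →⋆ₙₐ[ℂ] (HilbertTensor H K →L[ℂ] HilbertTensor H K),
      π' ≠ 0 ∧
      (∀ (x x' : X₂) (a a' : A₂), π' (stochasticGen x x' a a') = sliceJ E P (x, a) (x', a')) ∧
      π' 1 = opTensor (π 1) (ρ 1) := by
  have : Nonempty A₁ := StochasticCStar.nonempty_of_rep_ne_zero hπ
  obtain ⟨c, hc⟩ := StochasticCStar.exists_gen_eq_sum_star_mul.{u} (X := X₁) (A := A₁)
  obtain ⟨d, hd⟩ := StrongCStar.exists_gen_eq_sum_star_mul.{u} (X := X₂) (Y := A₁) (A := X₁)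
    (B := A₂)
  have hEc : ∀ s t, E s t = ∑ k, star (π (c k s)) * π (c k t) := fun s t => by
    rw [hE, Matrix.of_apply, hc]
    simp only [map_sum, map_mul, map_star]
  have hPd : ∀ s t, P s t = ∑ k, star (ρ (d k s)) * ρ (d k t) := fun s t => by
    rw [hP, Matrix.of_apply, hd]
    simp only [map_sum, map_mul, map_star]
  have hF := sliceJ_eq_sum_star_mul hEc hPd
  have htr : ∀ x x', ∑ a, sliceJ E P (x, a) (x', a)
      = if x = x' then opTensor (π 1) (ρ 1) else 0 := by
    subst hE hP
    exact sum_sliceJ π ρ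
  refine ⟨fun h1 => ⟨.of_eq_sum_star_mul _ hEc, ?_⟩, fun h1 => ?_, fun h1 h2 => ⟨?_, ?_⟩, ?_⟩
  · ext1 x x'
    simp only [opPartialTrace, Matrix.of_apply, hE, ← map_sum, StochasticCStar.sum_gen,
      Matrix.one_apply]
    split_ifs
    · exact h1
    · exact map_zero π
  · refine .of_relations (.of_eq_sum_star_mul _ hPd) ?_ ?_ ?_ ?_ ?_ <;> subst hP <;>
      simp only [Matrix.of_apply, ← map_sum]
    · intro x x' y y' b b'
      rw [StrongCStar.sum_fst_eq x x']
    · intro x x' y y' b b' h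
      rw [StrongCStar.sum_fst_eq_zero h, map_zero]
    · intro x x' y y' a a'
      rw [StrongCStar.sum_snd_eq x x' y y']
    · intro x x' y y' a a' h
      rw [StrongCStar.sum_snd_eq_zero x x' h, map_zero]
    · intro x x' y y'
      rw [StrongCStar.sum_sum_gen]
      split_ifs
      · exact h1
      · exact map_zero ρ
  · exact .of_eq_sum_star_mul _ hF
  · ext1 x x'
    simp only [opPartialTrace, Matrix.of_apply, htr, Matrix.one_apply, h1, h2, opTensor_one]
  · have hp0 := opTensor_ne_zero (map_one_ne_zero_of_ne_zero hπ) (map_one_ne_zero_of_ne_zero hρ)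
    -- The projection is `π(1) ⊗ ρ(1)`, and the Gram factor of `F` serves as `G`. It absorbs the
    -- projection on the right because `c * 1 = c` and `d * 1 = d` in the two algebras.
    obtain ⟨π', h1, h2⟩ := StochasticCStar.exists_rep (X := X₂) (A := A₂) hp0
      (by rw [opTensor_mul, ← map_mul, ← map_mul, one_mul, one_mul])
      (by rw [opTensor_star, ← map_star, ← map_star, star_one, star_one])
      (fun (k : (X₁ × A₁) × ((X₂ × A₁) × (X₁ × A₂))) a x => ∑ r : X₁ × A₁,
        opTensor (π (c k.1 r)) (ρ (d k.2 ((x, r.2), (r.1, a)))))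
      (fun k a x => by
        simp only [Finset.sum_mul, opTensor_mul, ← map_mul, mul_one])
      (fun x x' => by
        rw [← htr]
        exact Finset.sum_congr rfl fun a _ => (hF (x, a) (x', a)).symm)
    refine ⟨π', fun h => hp0 ?_, fun x x' a a' => ?_, h1⟩
    · rw [← h1, h]
      rfl
    · rw [h2, hF]
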